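/- Let $L\in\mathbb{R}^{n\times n}$ be normal ($LL^T=L^TL$, i.e. unitarily diagonalizable over $\mathbb{C}$), let $B=c\,I$ with $c\in\mathbb{R}$, let $X_0\in\mathbb{R}^n$ be deterministic, let $W$ be a standard $n$-dimensional Wiener process, and let $X$ be a solution of the stochastic differential equation $dX_t=LX_t\,dt+B\,dW_t$ with initial value $X_0$. For $k\ge 1$ let $\lambda_k=(k-\tfrac12)\pi$ be the frequencies of the Karhunen–Loève expansion $W_t=\sqrt2\sum_{k\ge1}Z_k\sin(\lambda_kt)/\lambda_k$ of $W$ on $[0,1]$, and let $$\varphi^{\cos}_{k,t}(z)=\int_0^t e^{(t-s)z}\cos(\lambda_k s)\,ds=\frac{z e^{zt}-z\cos(\lambda_kt)+\lambda_k\sin(\lambda_kt)}{z^2+\lambda_k^2}\qquad(z\in\mathbb{C}),$$ where the quotient is continued analytically to $z=\pm i\lambda_k$. Then for every $t\in[0,1]$ the random vector $X_t$ is square-integrable, the series below converges, and $$\mathbb{E}\left(\|X_t\|^2\right)=\left\|e^{tL}X_0\right\|^2+2c^2\sum_{k=1}^\infty\ \sum_{\lambda\in\Lambda(L)}\left|\varphi^{\cos}_{k,t}(\lambda)\right|^2,$$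 where $\|\cdot\|$ is the Euclidean norm and $\Lambda(L)$ is the spectrum of $L$ in $\mathbb{C}$, each eigenvalue being counted with its multiplicity. -/

import Mathlib

open MeasureTheory ProbabilityTheory
open scoped NNReal

noncomputable section

/-- A standard `n`-dimensional Wiener process: the coordinates are independent (as processes)
standard real Brownian motions. -/
structure IsStandardWiener {Ω : Type*} [MeasurableSpace Ω] {n : ℕ}
    (W : ℝ≥0 → Ω → EuclideanSpace ℝ (Fin n)) (P : Measure Ω) : Prop where
  isBrownian : ∀ i : Fin n, IsBrownianReal (fun t ω => W t ω i) P
  indep : iIndepFun (fun (i : Fin n) (ω : Ω) (t : ℝ≥0) => W t ω i) P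

/-- `X` is a solution of the linear SDE with additive noise `dX_t = L X_t dt + B dW_t` with
deterministic initial value `x₀`: almost surely, the path is continuous and, for all `t ≥ 0`,
`X_t = x₀ + ∫₀ᵗ L X_s ds + ∫₀ᵗ B dW_s`. Since `B` is constant, all the Riemann sums
`∑ B (W_{t_i} - W_{t_{i-1}})` that define the Itô integral are equal to `B (W_t - W_0)`. -/
structure IsLinearSDESolution {Ω : Type*} [MeasurableSpace Ω] {n : ℕ}
    (L B : Matrix (Fin n) (Fin n) ℝ) (W : ℝ≥0 → Ω → EuclideanSpace ℝ (Fin n))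
    (x₀ : EuclideanSpace ℝ (Fin n)) (X : ℝ≥0 → Ω → EuclideanSpace ℝ (Fin n))
    (P : Measure Ω) : Prop where
  continuous_paths : ∀ᵐ ω ∂P, Continuous (fun t => X t ω)
  integral_eq : ∀ᵐ ω ∂P, ∀ t : ℝ≥0,
    X t ω = x₀ + (∫ s in (0 : ℝ)..t, L.toEuclideanLin (X s.toNNReal ω))
      + B.toEuclideanLin (W t ω - W 0 ω)

/-- The frequencies `λ_k = (k - 1/2) π`, `k = 1, 2, …`, of the Karhunen–Loève expansion
`W_t = √2 ∑_{k ≥ 1} Z_k sin (λ_k t) / λ_k` of the Wiener process on `[0, 1]`. -/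
def klFreq (k : ℕ) : ℝ := ((k : ℝ) - 1 / 2) * Real.pi

/-- The trigonometric function `φ^cos_{k,t}(z) = ∫₀ᵗ e^{(t-s)z} cos (λ_k s) ds`, an entire
function of `z`, for a sequence `lam` of real frequencies. -/
def phiCos (lam : ℕ → ℝ) (k : ℕ) (t : ℝ) (z : ℂ) : ℂ :=
  ∫ s in (0 : ℝ)..t, Complex.exp (((t : ℂ) - (s : ℂ)) * z) * Complex.cos ((lam k : ℂ) * (s : ℂ))

/-- The closed form of `phiCos`; at the removable singularities `z = ± i λ_k` the integral gives
the value of the analytic continuation. -/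
theorem phiCos_eq (lam : ℕ → ℝ) (k : ℕ) (t : ℝ) (z : ℂ) (h : z ^ 2 + (lam k : ℂ) ^ 2 ≠ 0) :
    phiCos lam k t z =
      (z * Complex.exp (z * t) - z * Complex.cos (lam k * t) + lam k * Complex.sin (lam k * t))
        / (z ^ 2 + (lam k : ℂ) ^ 2) := by
  have hd : ∀ s ∈ Set.uIcc (0 : ℝ) t, HasDerivAt (fun s : ℝ =>
      Complex.exp (((t : ℂ) - (s : ℂ)) * z) *
        (lam k * Complex.sin (lam k * s) - z * Complex.cos (lam k * s))
        / (z ^ 2 + (lam k : ℂ) ^ 2))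
      (Complex.exp (((t : ℂ) - (s : ℂ)) * z) * Complex.cos ((lam k : ℂ) * (s : ℂ))) s := by
    intro s _
    have h0 : HasDerivAt (fun s : ℝ => (s : ℂ)) 1 s := Complex.ofRealCLM.hasDerivAt
    have h1 := ((h0.const_sub (t : ℂ)).mul_const z).cexp
    have h2 := ((Complex.hasDerivAt_sin _).comp s (h0.const_mul (lam k : ℂ))).const_mul (lam k : ℂ)
    have h3 := ((Complex.hasDerivAt_cos _).comp s (h0.const_mul (lam k : ℂ))).const_mul z
    refine ((h1.mul (h2.sub h3)).div_const _).congr_deriv ?_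
    rw [div_eq_iff h]
    simp only [Pi.sub_apply, Function.comp_apply]
    ring
  unfold phiCos
  rw [intervalIntegral.integral_eq_sub_of_hasDerivAt hd
    (Continuous.intervalIntegrable (by fun_prop) _ _)]
  simp only [sub_self, zero_mul, Complex.exp_zero, Complex.ofReal_zero, mul_zero, Complex.sin_zero,
    Complex.cos_zero, sub_zero, mul_comm z (t : ℂ)]
  ring

/-- The eigenvalues of a real square matrix in `ℂ`, repeated according to (algebraic)
multiplicity. -/
def complexEigenvalues {n : ℕ} (L : Matrix (Fin n) (Fin n) ℝ) : Multiset ℂ :=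
  (L.map (algebraMap ℝ ℂ)).charpoly.roots

end

/-! Normality gives a unitary `U` with `L = U diag(d) U*`. Because the noise matrix is scalar, the
equation decouples in the coordinates of the columns of `U`: the `j`-th one equals `e^{t d_j}` times
its initial value plus `c N_j`, with `N_j = ∑ᵢ conj(U i j) ∫₀ᵗ e^{(t-s) d_j} dWⁱ_s`
(`variation_of_constants`, `spectralCoord_solution`). `N_j` has centered Gaussian real and imaginary
parts, and since column `j` is a unit vector, `E|N_j|² = ∫₀ᵗ |e^{(t-s) d_j}|² ds`.

Parseval for the basis `√2 cos(λ_k s)` of `L²[0,1]`, applied to `e^{(t-s) d_j}` cut off to `(0,t]`,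
turns this integral into `2 ∑_k |φ^cos_{k,t}(d_j)|²` (`hasSum_sq_norm_phiCos`). Summing over `j`
gives the formula: `U` preserves norms, and `d` lists the eigenvalues with multiplicity.

The integrands are deterministic and `C¹`, so integration by parts defines the Wiener integrals path
by path; their Gaussian law is obtained as a limit of Riemann sums (`hasLaw_wienerIntegral`). -/

open Filter Topology

/-! ### Convergence of Riemann–Stieltjes sums -/

/-- Riemann–Stieltjes sums with arbitrary tags converge to the integral. -/
theorem tendsto_sum_integral_mul_tag {u w : ℝ → ℝ} (hu : Continuous u) (hw : Continuous w)
    {T : ℝ} (hT : 0 ≤ T) (τ : ℕ → ℕ → ℝ)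
    (hτ : ∀ N k : ℕ, k < N → τ N k ∈ Set.Icc (k * T / N) ((k + 1 : ℕ) * T / N)) :
    Tendsto (fun N : ℕ => ∑ k ∈ Finset.range N,
        (∫ s in (k * T / N : ℝ)..((k + 1 : ℕ) * T / N : ℝ), u s) * w (τ N k))
      atTop (𝓝 (∫ s in (0 : ℝ)..T, u s * w s)) := by
  obtain ⟨C, hC⟩ := isCompact_Icc.exists_bound_of_continuousOn (s := Set.Icc 0 T) hu.continuousOn
  have hC0 : 0 ≤ C := (norm_nonneg _).trans (hC 0 ⟨le_rfl, hT⟩)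
  have huc := isCompact_Icc.uniformContinuousOn_of_continuous (s := Set.Icc 0 T) hw.continuousOn
  rw [Metric.tendsto_atTop]
  intro ε hε
  -- The `N` local errors add up to `ε * (C * T / (C * T + 1)) < ε`; the `+ 1` also covers `C * T =
  -- 0`.
  obtain ⟨δ, hδ, hd⟩ := Metric.uniformContinuousOn_iff.1 huc (ε / (C * T + 1)) (by positivity)
  obtain ⟨N₀, hN₀⟩ := exists_nat_gt (T / δ)
  refine ⟨N₀ + 1, fun N hN => ?_⟩
  have hNpos : (0 : ℝ) < N := by exact_mod_cast (by omega : 0 < N)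
  have hNT : T / N < δ := by
    rw [div_lt_iff₀ hNpos]
    rw [div_lt_iff₀ hδ] at hN₀
    have : (N₀ : ℝ) ≤ N := by exact_mod_cast (by omega : N₀ ≤ N)
    nlinarith
  have hmono : ∀ k : ℕ, (k * T / N : ℝ) ≤ ((k + 1 : ℕ) * T / N : ℝ) := fun k => by
    push_cast; gcongr; linarith
  have hlen : ∀ k : ℕ, ((k + 1 : ℕ) * T / N : ℝ) - (k * T / N : ℝ) = T / N := fun k => by
    push_cast; ring
  have hsplit : ∫ s in (0 : ℝ)..T, u s * w s = ∑ k ∈ Finset.range N,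
      ∫ s in (k * T / N : ℝ)..((k + 1 : ℕ) * T / N : ℝ), u s * w s := by
    rw [intervalIntegral.sum_integral_adjacent_intervals (a := fun k : ℕ => (k * T / N : ℝ))
      (f := fun s => u s * w s) (fun k _ => (hu.mul hw).intervalIntegrable _ _)]
    have : (N : ℝ) * T / N = T := by field_simp
    simp [this]
  have hterm : ∀ k ∈ Finset.range N,
      ‖(∫ s in (k * T / N : ℝ)..((k + 1 : ℕ) * T / N : ℝ), u s) * w (τ N k) -
        ∫ s in (k * T / N : ℝ)..((k + 1 : ℕ) * T / N : ℝ), u s * w s‖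
        ≤ C * (ε / (C * T + 1)) * (T / N) := by
    intro k hk
    have hk := Finset.mem_range.1 hk
    have h0 : (0 : ℝ) ≤ k * T / N := by positivity
    have h1 : ((k + 1 : ℕ) * T / N : ℝ) ≤ T := by
      rw [div_le_iff₀ hNpos, mul_comm T]
      gcongr
      exact hk
    rw [← intervalIntegral.integral_mul_const, ← intervalIntegral.integral_sub
      (Continuous.intervalIntegrable (by fun_prop) _ _)
      (Continuous.intervalIntegrable (by fun_prop) _ _)]
    refine (intervalIntegral.norm_integral_le_of_norm_le_const fun s hs => ?_).trans_eq
      (by rw [hlen, abs_of_nonneg (by positivity)])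
    rw [Set.uIoc_of_le (hmono k)] at hs
    rw [← mul_sub, norm_mul]
    have hτk := hτ N k hk
    have hsI : s ∈ Set.Icc 0 T := ⟨h0.trans hs.1.le, hs.2.trans h1⟩
    refine mul_le_mul (hC s hsI) ?_ (norm_nonneg _) hC0
    rw [← dist_eq_norm]
    refine (hd _ ⟨h0.trans hτk.1, hτk.2.trans h1⟩ _ hsI ?_).le
    refine lt_of_le_of_lt ?_ hNT
    rw [Real.dist_eq, abs_le, ← hlen k]
    constructor <;> linarith [hτk.1, hτk.2, hs.1, hs.2]
  rw [hsplit, dist_eq_norm, ← Finset.sum_sub_distrib]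
  refine ((norm_sum_le _ _).trans (Finset.sum_le_sum hterm)).trans_lt ?_
  rw [Finset.sum_const, Finset.card_range, nsmul_eq_mul]
  have : (N : ℝ) * (C * (ε / (C * T + 1)) * (T / N)) = ε * (C * T / (C * T + 1)) := by
    field_simp
  rw [this]
  refine mul_lt_of_lt_one_right hε ?_
  rw [div_lt_one (by positivity)]
  linarith

/-- Left-endpoint Riemann sums converge to the integral. -/
theorem tendsto_riemann_sum {w : ℝ → ℝ} (hw : Continuous w) {T : ℝ} (hT : 0 ≤ T) :
    Tendsto (fun N : ℕ => ∑ k ∈ Finset.range N, T / N * w (k * T / N))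
      atTop (𝓝 (∫ s in (0 : ℝ)..T, w s)) := by
  have h := tendsto_sum_integral_mul_tag (u := fun _ => 1) continuous_const hw hT
    (fun N k => k * T / N) fun (N k : ℕ) _ => ⟨le_rfl, by push_cast; gcongr; linarith⟩
  simp only [one_mul] at h
  refine h.congr fun N => Finset.sum_congr rfl fun k _ => ?_
  rw [intervalIntegral.integral_const, smul_eq_mul, mul_one]
  push_cast
  ring

/-- Left-endpoint Riemann–Stieltjes sums against a continuous path `b` that starts at zero converge
to the integral defined through integration by parts. -/
theorem tendsto_stieltjes_sum {h h' b : ℝ → ℝ} (hh : ∀ s, HasDerivAt h (h' s) s)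
    (hh' : Continuous h') (hb : Continuous b) (hb0 : b 0 = 0) {T : ℝ} (hT : 0 ≤ T) :
    Tendsto (fun N : ℕ => ∑ k ∈ Finset.range N,
        h (k * T / N) * (b ((k + 1 : ℕ) * T / N) - b (k * T / N)))
      atTop (𝓝 (h T * b T - ∫ s in (0 : ℝ)..T, h' s * b s)) := by
  -- Summation by parts pairs each increment of `h` with the value of `b` at the right endpoint,
  -- hence these tags.
  have hlim := (tendsto_sum_integral_mul_tag hh' hb hT
    (fun N k => (k + 1 : ℕ) * T / N) fun (N k : ℕ) _ => ⟨by push_cast; gcongr; linarith, le_rfl⟩).const_sub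
      (h T * b T)
  refine hlim.congr' ?_
  filter_upwards [eventually_gt_atTop 0] with N hN
  have hN' : (N : ℝ) ≠ 0 := by exact_mod_cast hN.ne'
  have hft : ∀ k : ℕ, ∫ s in (k * T / N : ℝ)..((k + 1 : ℕ) * T / N : ℝ), h' s =
      h ((k + 1 : ℕ) * T / N) - h (k * T / N) := fun k =>
    intervalIntegral.integral_eq_sub_of_hasDerivAt (fun s _ => hh s)
      (hh'.intervalIntegrable _ _)
  have htel := Finset.sum_range_sub (fun k : ℕ => h (k * T / N) * b (k * T / N)) N
  have e1 : (N : ℝ) * T / N = T := by field_simp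
  simp only [e1, Nat.cast_zero, zero_mul, zero_div, hb0, mul_zero, sub_zero] at htel
  rw [← htel, ← Finset.sum_sub_distrib]
  refine Finset.sum_congr rfl fun k _ => ?_
  rw [hft]
  ring

/-! ### Gaussian laws and the Wiener integral -/

section WienerIntegral

variable {Ω : Type*} [MeasurableSpace Ω] {P : Measure Ω}

theorem hasLaw_gaussianReal_of_charFun [IsFiniteMeasure P] {R : Ω → ℝ} (hR : AEMeasurable R P)
    {v : ℝ≥0} (h : ∀ u : ℝ, charFun (P.map R) u = Complex.exp (-(v * u ^ 2 / 2))) :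
    HasLaw R (gaussianReal 0 v) P where
  aemeasurable := hR
  map_eq := by
    refine Measure.ext_of_charFun (funext fun u => ?_)
    rw [h, charFun_gaussianReal]
    simp

theorem charFun_of_hasLaw_gaussianReal {R : Ω → ℝ} {v : ℝ≥0}
    (h : HasLaw R (gaussianReal 0 v) P) (u : ℝ) :
    charFun (P.map R) u = Complex.exp (-(v * u ^ 2 / 2)) := by
  rw [h.map_eq, charFun_gaussianReal]
  simp

/-- A sum of independent centered real Gaussians is Gaussian, and the variances add up. -/
theorem hasLaw_gaussianReal_sum [IsFiniteMeasure P] {ι : Type*} {R : ι → Ω → ℝ} {v : ι → ℝ≥0}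
    (hind : iIndepFun R P) (h : ∀ i, HasLaw (R i) (gaussianReal 0 (v i)) P) (s : Finset ι) :
    HasLaw (fun ω => ∑ i ∈ s, R i ω) (gaussianReal 0 (∑ i ∈ s, v i)) P := by
  refine hasLaw_gaussianReal_of_charFun
    (Finset.aemeasurable_fun_sum s fun i _ => (h i).aemeasurable) fun u => ?_
  rw [(hind.restrict s).charFun_map_fun_finsetSum_eq_prod fun i _ => (h i).aemeasurable,
    Finset.prod_apply]
  simp_rw [fun i => charFun_of_hasLaw_gaussianReal (h i) u]
  rw [← Complex.exp_sum, Finset.sum_neg_distrib, ← Finset.sum_div, ← Finset.sum_mul]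
  push_cast
  rfl

/-- An almost sure limit of centered Gaussians with convergent variances is Gaussian. -/
theorem hasLaw_gaussianReal_of_tendsto [IsProbabilityMeasure P] {S : ℕ → Ω → ℝ} {R : Ω → ℝ}
    {v : ℕ → ℝ≥0} {σ : ℝ≥0} (hS : ∀ N, HasLaw (S N) (gaussianReal 0 (v N)) P)
    (hlim : ∀ᵐ ω ∂P, Tendsto (fun N => S N ω) atTop (𝓝 (R ω)))
    (hv : Tendsto v atTop (𝓝 σ)) : HasLaw R (gaussianReal 0 σ) P := by
  have hR : AEMeasurable R P := aemeasurable_of_tendsto_metrizable_ae atTop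
    (fun N => (hS N).aemeasurable) hlim
  refine hasLaw_gaussianReal_of_charFun hR fun u => ?_
  have hint : ∀ Q : Ω → ℝ, AEMeasurable Q P →
      charFun (P.map Q) u = ∫ ω, Complex.exp (u * Q ω * Complex.I) ∂P := fun Q hQ => by
    rw [charFun_apply_real, integral_map hQ]
    exact Continuous.aestronglyMeasurable (by fun_prop)
  have h1 : Tendsto (fun N => charFun (P.map (S N)) u) atTop (𝓝 (charFun (P.map R) u)) := by
    simp_rw [fun N => hint (S N) (hS N).aemeasurable, hint R hR]
    refine tendsto_integral_of_dominated_convergence (fun _ => 1)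
      (fun N => ?_) (integrable_const _) (fun N => ?_) ?_
    · have hm : Measurable fun x : ℝ => Complex.exp (u * x * Complex.I) := by fun_prop
      exact (hm.comp_aemeasurable (hS N).aemeasurable).aestronglyMeasurable
    · refine Eventually.of_forall fun ω => ?_
      rw [← Complex.ofReal_mul, Complex.norm_exp_ofReal_mul_I]
    · filter_upwards [hlim] with ω hω
      have hc : Continuous fun x : ℝ => Complex.exp (u * x * Complex.I) := by fun_prop
      exact (hc.tendsto _).comp hω
  refine tendsto_nhds_unique h1 ?_
  simp_rw [fun N => charFun_of_hasLaw_gaussianReal (hS N) u]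
  have hc : Continuous fun x : ℝ≥0 => Complex.exp (-((x : ℝ) * u ^ 2 / 2 : ℂ)) := by fun_prop
  exact (hc.tendsto _).comp hv

/-- The law of a Wiener-type Riemann sum of a step integrand against Brownian motion. -/
theorem hasLaw_sum_mul_increments {B : ℝ≥0 → Ω → ℝ} (hB : IsPreBrownianReal B P)
    {r : ℕ → ℝ≥0} (hr : Monotone r) (a : ℕ → ℝ) (N : ℕ) :
    HasLaw (fun ω => ∑ k ∈ Finset.range N, a k * (B (r (k + 1)) ω - B (r k) ω))
      (gaussianReal 0 (∑ k ∈ Finset.range N, ((a k) ^ 2).toNNReal * (r (k + 1) - r k))) P := by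
  have := hB.isGaussianProcess.isProbabilityMeasure
  refine hasLaw_gaussianReal_sum
    (R := fun k ω => a k * (B (r (k + 1)) ω - B (r k) ω)) ?_ (fun k => ?_) _
  · exact (hB.hasIndepIncrements.nat hr).comp (fun k x => a k * x) fun k => by fun_prop
  · have h := gaussianReal_const_mul (hB.hasLaw_sub (r (k + 1)) (r k)) (a k)
    rw [mul_zero] at h
    have e : nndist (r (k + 1)).1 (r k).1 = r (k + 1) - r k := by
      rw [← NNReal.coe_inj, coe_nndist, NNReal.coe_sub (hr k.le_succ), Real.dist_eq, abs_of_nonneg]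
      · rfl
      · exact sub_nonneg.2 (hr k.le_succ)
    rw [e] at h
    have e' : ((a k) ^ 2).toNNReal = NNReal.mk ((a k) ^ 2) (sq_nonneg _) := by
      rw [← NNReal.coe_inj, Real.coe_toNNReal _ (sq_nonneg _)]
      rfl
    rw [e']
    exact h

/-- The Wiener integral of a vector of `C¹` integrands against an `n`-dimensional Wiener process,
defined through integration by parts. -/
theorem hasLaw_wienerIntegral [IsProbabilityMeasure P] {n : ℕ}
    {W : ℝ≥0 → Ω → EuclideanSpace ℝ (Fin n)} (hW : IsStandardWiener W P)
    {h h' : Fin n → ℝ → ℝ} (hh : ∀ i s, HasDerivAt (h i) (h' i s) s)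
    (hh' : ∀ i, Continuous (h' i)) (t : ℝ≥0) :
    HasLaw (fun ω => ∑ i, (h i t * W t ω i - ∫ s in (0 : ℝ)..t, h' i s * W s.toNNReal ω i))
      (gaussianReal 0 (∑ i, ∫ s in (0 : ℝ)..t, h i s ^ 2).toNNReal) P := by
  have hc : ∀ i, Continuous (h i) := fun i =>
    continuous_iff_continuousAt.2 fun s => (hh i s).continuousAt
  set r : ℕ → ℕ → ℝ≥0 := fun N k => k * t / N with hr
  have hrm : ∀ N, Monotone (r N) := fun N k l hkl => by
    simp only [hr]
    gcongr
  refine hasLaw_gaussianReal_of_tendsto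
    (S := fun N ω => ∑ i, ∑ k ∈ Finset.range N,
      h i (r N k) * (W (r N (k + 1)) ω i - W (r N k) ω i))
    (v := fun N => ∑ i, ∑ k ∈ Finset.range N,
      (h i (r N k) ^ 2).toNNReal * (r N (k + 1) - r N k)) (fun N => ?_) ?_ ?_
  · refine hasLaw_gaussianReal_sum (R := fun i ω => ∑ k ∈ Finset.range N,
      h i (r N k) * (W (r N (k + 1)) ω i - W (r N k) ω i)) ?_
      (fun i => hasLaw_sum_mul_increments (hW.isBrownian i).toIsPreBrownianReal (hrm N) _ N) _
    -- Each inner sum is a measurable function of one coordinate path, so independence of the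
    -- coordinate processes passes to these sums.
    exact hW.indep.comp (fun i b => ∑ k ∈ Finset.range N,
      h i (r N k) * (b (r N (k + 1)) - b (r N k))) fun i => by fun_prop
  · have hc : ∀ᵐ ω ∂P, ∀ i, Continuous (fun s => W s ω i) :=
      ae_all_iff.2 fun i => (hW.isBrownian i).cont
    have h0 : ∀ᵐ ω ∂P, ∀ i, W 0 ω i = 0 :=
      ae_all_iff.2 fun i => (hW.isBrownian i).eval_zero_ae_eq_zero
    filter_upwards [hc, h0] with ω hcω h0ω
    refine tendsto_finsetSum _ fun i _ => ?_
    have key := tendsto_stieltjes_sum (hh i) (hh' i)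
      (b := fun s => W s.toNNReal ω i) ((hcω i).comp continuous_real_toNNReal)
      (by simpa using h0ω i) t.2
    have e : ∀ N k : ℕ, ((k * t / N : ℝ)).toNNReal = r N k := fun N k => by
      rw [← Real.toNNReal_coe (r := r N k)]
      simp [hr]
    have e2 : ∀ N k : ℕ, ((r N k : ℝ≥0) : ℝ) = k * t / N := fun N k => by simp [hr]
    simp only [NNReal.val_eq_coe, e, Real.toNNReal_coe] at key
    simpa only [e2] using key
  · have hnn : 0 ≤ ∑ i, ∫ s in (0 : ℝ)..t, h i s ^ 2 := Finset.sum_nonneg fun i _ =>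
      intervalIntegral.integral_nonneg t.2 fun s _ => sq_nonneg _
    rw [← NNReal.tendsto_coe, Real.coe_toNNReal _ hnn]
    push_cast
    refine tendsto_finsetSum _ fun i _ => ?_
    refine (tendsto_riemann_sum ((hc i).pow 2) t.2).congr fun N => Finset.sum_congr rfl
      fun k _ => ?_
    rw [NNReal.coe_sub (hrm N k.le_succ), Real.coe_toNNReal _ (sq_nonneg _)]
    simp only [hr, NNReal.coe_div, NNReal.coe_mul, NNReal.coe_natCast, NNReal.val_eq_coe,
      Pi.pow_apply]
    push_cast
    ring

theorem memLp_of_hasLaw_gaussianReal {R : Ω → ℝ} {v : ℝ≥0}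
    (h : HasLaw R (gaussianReal 0 v) P) : MemLp R 2 P :=
  h.hasGaussianLaw.memLp_two

/-- The second moment of a shifted centered Gaussian. -/
theorem integral_add_mul_sq_of_hasLaw_gaussianReal [IsProbabilityMeasure P] {R : Ω → ℝ} {v : ℝ≥0}
    (h : HasLaw R (gaussianReal 0 v) P) (e c : ℝ) :
    ∫ ω, (e + c * R ω) ^ 2 ∂P = e ^ 2 + c ^ 2 * v := by
  have hm := memLp_of_hasLaw_gaussianReal h
  have h0 : ∫ ω, R ω ∂P = 0 := by rw [h.integral_eq, integral_id_gaussianReal]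
  have h2 : ∫ ω, R ω ^ 2 ∂P = v := by
    have := h.variance_eq
    rwa [variance_id_gaussianReal, variance_of_integral_eq_zero h.aemeasurable h0] at this
  have hi : Integrable R P := hm.integrable (by norm_num)
  have e1 : ∀ ω, (e + c * R ω) ^ 2 = e ^ 2 + 2 * e * c * R ω + c ^ 2 * R ω ^ 2 := fun ω => by ring
  simp_rw [e1]
  have hi2 : Integrable (fun ω => e ^ 2 + 2 * e * c * R ω) P :=
    (integrable_const _).add (hi.const_mul _)
  rw [integral_add hi2 (hm.integrable_sq.const_mul _), integral_add (integrable_const _)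
    (hi.const_mul _), integral_const_mul, integral_const_mul,
    h0, h2]
  simp

end WienerIntegral

/-! ### Variation of constants -/

/-- Variation of constants for a scalar linear integral equation with a continuous forcing. -/
theorem variation_of_constants {Y M : ℝ → ℂ} (hY : Continuous Y) (hM : Continuous M)
    {y z c : ℂ} {t : ℝ} (ht : 0 ≤ t)
    (h : ∀ s ∈ Set.Icc 0 t, Y s = y + (∫ r in (0 : ℝ)..s, z * Y r) + c * M s) :
    Y t = Complex.exp (t * z) * y +
      c * (M t + ∫ s in (0 : ℝ)..t, z * Complex.exp (((t : ℂ) - s) * z) * M s) := by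
  have hexp : ∀ s : ℝ, HasDerivAt (fun s : ℝ => Complex.exp (((t : ℂ) - s) * z))
      (-(z * Complex.exp (((t : ℂ) - s) * z))) s := fun s => by
    have h0 : HasDerivAt (fun s : ℝ => (s : ℂ)) 1 s := Complex.ofRealCLM.hasDerivAt
    refine ((h0.const_sub (t : ℂ)).mul_const z).cexp.congr_deriv ?_
    ring
  have hZ : ∀ s : ℝ, HasDerivAt (fun s : ℝ => ∫ r in (0 : ℝ)..s, z * Y r) (z * Y s) s := fun s =>
    ((continuous_const.mul hY).integral_hasStrictDerivAt 0 s).hasDerivAt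
  -- Only `∫ z Y + y` is differentiated, so `M` need not be differentiable. Multiplied by the
  -- integrating factor, its derivative is `z e^{(t-s)z} (Y - ∫ z Y - y)`, and the last factor is `c
  -- M`.
  have hF := intervalIntegral.integral_eq_sub_of_hasDerivAt (a := 0) (b := t)
    (f := fun s : ℝ => Complex.exp (((t : ℂ) - s) * z) * (∫ r in (0 : ℝ)..s, z * Y r)
      + Complex.exp (((t : ℂ) - s) * z) * y)
    (f' := fun s : ℝ => c * (z * Complex.exp (((t : ℂ) - s) * z) * M s))
    (fun s hs => by
      rw [Set.uIcc_of_le ht] at hs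
      refine (((hexp s).mul (hZ s)).add ((hexp s).mul_const y)).congr_deriv ?_
      rw [h s hs]
      ring) (Continuous.intervalIntegrable (by fun_prop) _ _)
  rw [intervalIntegral.integral_const_mul] at hF
  simp only [sub_self, zero_mul, Complex.exp_zero, intervalIntegral.integral_same, mul_zero,
    zero_add, one_mul, Complex.ofReal_zero, sub_zero] at hF
  rw [h t ⟨ht, le_rfl⟩, mul_add, hF]
  ring

/-! ### Parseval for half-integer cosines -/

theorem integral_neg_one_one_eq {F : ℝ → ℂ} (h1 : IntervalIntegrable F volume 0 1)
    (h2 : IntervalIntegrable (fun s => F (-s)) volume 0 1) :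
    ∫ s in (-1 : ℝ)..1, F s = ∫ s in (0 : ℝ)..1, (F s + F (-s)) := by
  have h3 : IntervalIntegrable F volume (-1) 0 := by
    simpa using ((IntervalIntegrable.iff_comp_neg (by finiteness)).1 h2).symm
  rw [← intervalIntegral.integral_add_adjacent_intervals h3 h1,
    intervalIntegral.integral_add h1 h2, intervalIntegral.integral_comp_neg]
  simp [add_comm]

theorem intervalIntegrable_of_measurable_of_bound {g : ℝ → ℂ} (hg : Measurable g) {C : ℝ}
    (hC : ∀ s, ‖g s‖ ≤ C) (a b : ℝ) : IntervalIntegrable g volume a b := by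
  refine (intervalIntegrable_const (c := C)).mono_fun hg.aestronglyMeasurable
    (Eventually.of_forall fun s => ?_)
  exact (hC s).trans (le_abs_self C)

/-- Parseval's identity on `[0, 1]` for the orthonormal basis `√2 cos ((k + 1/2) π s)`. -/
theorem hasSum_sq_integral_mul_cos {f : ℝ → ℂ} (hf : Measurable f) {C : ℝ}
    (hC : ∀ s, ‖f s‖ ≤ C) :
    HasSum (fun k : ℕ => 2 * ‖∫ s in (0 : ℝ)..1, f s * Complex.cos (((k : ℂ) + 1 / 2) * Real.pi * s)‖ ^ 2)
      (∫ s in (0 : ℝ)..1, ‖f s‖ ^ 2) := by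
  have hlt : (-1 : ℝ) < 1 := by norm_num
  -- On `[-1, 1]` the Fourier modes have frequencies `nπ`. The phase `e^{-iπs/2}` shifts them to `(n
  -- + 1/2)π`, and the even extension of `f` leaves only the cosine part.
  set g : ℝ → ℂ := fun s => f |s| * Complex.exp (-(Real.pi / 2 * s : ℝ) * Complex.I) with hg
  have hgm : Measurable g := by fun_prop
  have hgn : ∀ s, ‖g s‖ = ‖f |s|‖ := fun s => by
    rw [hg]
    simp only [norm_mul]
    rw [← Complex.ofReal_neg, Complex.norm_exp_ofReal_mul_I, mul_one]
  have hcoef : ∀ n : ℤ, fourierCoeffOn hlt g n =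
      ∫ s in (0 : ℝ)..1, f s * Complex.cos (((n : ℂ) + 1 / 2) * Real.pi * s) := fun n => by
    rw [fourierCoeffOn_eq_integral]
    have e : ∀ s : ℝ, fourier (-n) (s : AddCircle (1 - -1 : ℝ)) • g s =
        f |s| * Complex.exp ((-(((n : ℝ) + 1 / 2) * Real.pi * s) : ℝ) * Complex.I) := fun s => by
      rw [fourier_coe_apply, hg, smul_eq_mul, mul_left_comm, ← Complex.exp_add]
      congr 2
      push_cast
      ring
    have hb : ∀ s : ℝ, ‖f |s| * Complex.exp ((-(((n : ℝ) + 1 / 2) * Real.pi * s) : ℝ) * Complex.I)‖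
        ≤ C := fun s => by
      rw [norm_mul, Complex.norm_exp_ofReal_mul_I, mul_one]
      exact hC _
    simp_rw [e]
    rw [integral_neg_one_one_eq
      (intervalIntegrable_of_measurable_of_bound (by fun_prop) hb _ _)
      (intervalIntegrable_of_measurable_of_bound (by fun_prop) (fun s => hb (-s)) _ _),
      ← intervalIntegral.integral_smul]
    refine intervalIntegral.integral_congr fun s hs => ?_
    rw [Set.uIcc_of_le zero_le_one] at hs
    simp only [abs_neg, abs_of_nonneg hs.1, Complex.cos]
    rw [Complex.real_smul]
    push_cast
    ring_nf
  -- The modes `n` and `-(n + 1)` have opposite shifted frequencies, hence equal coefficients.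
  -- Pairing them yields the factor `2` and a sum over `ℕ`.
  have hP := (hasSum_sq_fourierCoeffOn hlt (f := g) (MemLp.of_bound hgm.aestronglyMeasurable C
    (Eventually.of_forall fun s => (hgn s).trans_le (hC _)))).nat_add_neg_add_one
  have hval : ((1 : ℝ) - -1)⁻¹ • ∫ x in (-1 : ℝ)..1, ‖g x‖ ^ 2 = ∫ s in (0 : ℝ)..1, ‖f s‖ ^ 2 := by
    have hb : ∀ s : ℝ, ‖((‖f |s|‖ ^ 2 : ℝ) : ℂ)‖ ≤ C ^ 2 := fun s => by
      rw [Complex.norm_real, norm_pow, norm_norm]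
      exact pow_le_pow_left₀ (norm_nonneg _) (hC _) 2
    have h2 := integral_neg_one_one_eq (F := fun s => ((‖f |s|‖ ^ 2 : ℝ) : ℂ))
      (intervalIntegrable_of_measurable_of_bound (by fun_prop) hb _ _)
      (intervalIntegrable_of_measurable_of_bound (by fun_prop) (fun s => hb (-s)) _ _)
    simp only [abs_neg, ← Complex.ofReal_add] at h2
    rw [intervalIntegral.integral_ofReal, intervalIntegral.integral_ofReal] at h2
    simp_rw [hgn]
    rw [Complex.ofReal_inj.1 h2, smul_eq_mul, ← intervalIntegral.integral_const_mul]
    refine intervalIntegral.integral_congr fun s hs => ?_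
    rw [Set.uIcc_of_le zero_le_one] at hs
    simp only [abs_of_nonneg hs.1]
    ring
  rw [hval] at hP
  refine hP.congr_fun fun k => ?_
  have hsymm : ∫ s in (0 : ℝ)..1, f s * Complex.cos ((((-(k + 1 : ℤ) : ℤ) : ℂ) + 1 / 2) * Real.pi * s)
      = ∫ s in (0 : ℝ)..1, f s * Complex.cos (((k : ℂ) + 1 / 2) * Real.pi * s) := by
    congr 1
    funext s
    rw [← Complex.cos_neg]
    congr 2
    push_cast
    ring
  rw [hcoef, hcoef, hsymm, two_mul]
  push_cast
  rfl

/-- Parseval's identity for the functions `φ^cos_{k,t}(z)` at a point `z`. -/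
theorem hasSum_sq_norm_phiCos {t : ℝ} (ht0 : 0 ≤ t) (ht1 : t ≤ 1) (z : ℂ) :
    HasSum (fun k : ℕ => 2 * ‖phiCos klFreq (k + 1) t z‖ ^ 2)
      (∫ s in (0 : ℝ)..t, ‖Complex.exp (((t : ℂ) - s) * z)‖ ^ 2) := by
  -- As `t ≤ 1`, the cosine coefficients on `[0, 1]` of this truncation are the integrals over `[0,
  -- t]` that define `phiCos`; `klFreq (k + 1) = (k + 1/2)π` matches the indices.
  set f : ℝ → ℂ := (Set.Ioc 0 t).indicator fun s => Complex.exp (((t : ℂ) - s) * z) with hf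
  have hc : Continuous fun s : ℝ => Complex.exp (((t : ℂ) - s) * z) := by fun_prop
  obtain ⟨C, hC⟩ := isCompact_Icc.exists_bound_of_continuousOn (s := Set.Icc 0 t) hc.continuousOn
  have hC0 : 0 ≤ C := (norm_nonneg _).trans (hC 0 ⟨le_rfl, ht0⟩)
  have hfm : Measurable f := hc.measurable.indicator measurableSet_Ioc
  have hfC : ∀ s, ‖f s‖ ≤ C := fun s => by
    by_cases hs : s ∈ Set.Ioc 0 t
    · rw [hf, Set.indicator_of_mem hs]
      exact hC s ⟨hs.1.le, hs.2⟩
    · rw [hf, Set.indicator_of_notMem hs, norm_zero]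
      exact hC0
  have hsub : Set.Ioc 0 t ∩ Set.Ioc 0 1 = Set.Ioc 0 t := by
    rw [Set.inter_eq_left]
    exact Set.Ioc_subset_Ioc_right ht1
  convert! hasSum_sq_integral_mul_cos hfm hfC using 1
  · funext k
    congr 3
    have e : ∀ s : ℝ, f s * Complex.cos (((k : ℂ) + 1 / 2) * Real.pi * s) =
        (Set.Ioc 0 t).indicator (fun s : ℝ => Complex.exp (((t : ℂ) - s) * z) *
          Complex.cos (((k : ℂ) + 1 / 2) * Real.pi * s)) s := fun s => by
      rw [hf]
      by_cases hs : s ∈ Set.Ioc 0 t <;> simp [hs]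
    simp_rw [e]
    rw [intervalIntegral.integral_of_le zero_le_one, integral_indicator measurableSet_Ioc,
      Measure.restrict_restrict measurableSet_Ioc, hsub, ← intervalIntegral.integral_of_le ht0]
    unfold phiCos klFreq
    refine intervalIntegral.integral_congr fun s _ => ?_
    congr 2
    push_cast
    ring
  · have e : ∀ s : ℝ, ‖f s‖ ^ 2 =
        (Set.Ioc 0 t).indicator (fun s : ℝ => ‖Complex.exp (((t : ℂ) - s) * z)‖ ^ 2) s := fun s => by
      rw [hf]
      by_cases hs : s ∈ Set.Ioc 0 t <;> simp [hs]
    simp_rw [e]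
    rw [intervalIntegral.integral_of_le zero_le_one, integral_indicator measurableSet_Ioc,
      Measure.restrict_restrict measurableSet_Ioc, hsub, ← intervalIntegral.integral_of_le ht0]

/-! ### Unitary diagonalization of normal matrices -/

/-- The spectral theorem for normal complex matrices. -/
theorem Matrix.exists_unitary_diagonalization {n : ℕ} (A : Matrix (Fin n) (Fin n) ℂ)
    (hA : IsStarNormal A) : ∃ U ∈ Matrix.unitaryGroup (Fin n) ℂ, ∃ d : Fin n → ℂ,
      A = U * Matrix.diagonal d * star U := by
  have hcomm : star A * A = A * star A := hA.star_comm_self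
  -- Normality makes the Hermitian matrices `S` and `D` commute, and `A = (S - iD) / 2`; a joint
  -- orthonormal eigenbasis of the two therefore diagonalizes `A`.
  set S : Matrix (Fin n) (Fin n) ℂ := A + star A with hS
  set D : Matrix (Fin n) (Fin n) ℂ := Complex.I • (A - star A) with hD
  have hSs : S.IsHermitian := by
    rw [Matrix.IsHermitian, ← Matrix.star_eq_conjTranspose, hS, star_add, star_star, add_comm]
  have hDs : D.IsHermitian := by
    rw [Matrix.IsHermitian, ← Matrix.star_eq_conjTranspose, hD, star_smul, star_sub, star_star,
      Complex.star_def, Complex.conj_I, neg_smul, ← smul_neg, neg_sub]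
  have hSD : Commute S D := by
    rw [Commute, SemiconjBy, hS, hD, mul_smul_comm, smul_mul_assoc]
    congr 1
    rw [add_mul, mul_sub, mul_sub, sub_mul, mul_add, mul_add, hcomm]
    abel
  have hA2 : A = (2⁻¹ : ℂ) • (S - Complex.I • D) := by
    rw [hS, hD, smul_smul, Complex.I_mul_I, neg_smul, one_smul, sub_neg_eq_add,
      show A + star A + (A - star A) = (2 : ℂ) • A by rw [two_smul]; abel, smul_smul]
    norm_num
  have hTS := Matrix.isSymmetric_toEuclideanLin_iff.2 hSs
  have hTD := Matrix.isSymmetric_toEuclideanLin_iff.2 hDs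
  have hTSD : Commute S.toEuclideanLin D.toEuclideanLin := by
    refine LinearMap.ext fun v => ?_
    have := congrArg (fun M : Matrix (Fin n) (Fin n) ℂ => M.toEuclideanLin v) hSD.eq
    simpa [Matrix.toLpLin_apply, Matrix.mulVec_mulVec] using this
  classical
  have hint0 := LinearMap.IsSymmetric.directSum_isInternal_of_commute hTS hTD hTSD
  have horth0 := LinearMap.IsSymmetric.orthogonalFamily_eigenspace_inf_eigenspace hTS hTD
  -- The joint eigenspaces are indexed by all of `ℂ × ℂ`; keeping only the nonzero ones leaves a
  -- finite index type.
  have hint := DirectSum.isInternal_ne_bot_iff.2 hint0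
  have horth := horth0.comp (γ := {i : ℂ × ℂ // Module.End.eigenspace S.toEuclideanLin i.2 ⊓
    Module.End.eigenspace D.toEuclideanLin i.1 ≠ ⊥}) Subtype.val_injective
  let := horth0.independent.fintypeNeBotOfFiniteDimensional
  have hn : Module.finrank ℂ (EuclideanSpace ℂ (Fin n)) = n := finrank_euclideanSpace_fin
  set b := hint.subordinateOrthonormalBasis hn horth with hb
  set ix := fun j => hint.subordinateOrthonormalBasisIndex hn j horth with hix
  have hmem : ∀ j, S.toEuclideanLin (b j) = (ix j).1.2 • b j ∧
      D.toEuclideanLin (b j) = (ix j).1.1 • b j := fun j => by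
    have := hint.subordinateOrthonormalBasis_subordinate hn j horth
    exact ⟨Module.End.mem_eigenspace_iff.1 this.1, Module.End.mem_eigenspace_iff.1 this.2⟩
  set d : Fin n → ℂ := fun j => 2⁻¹ * ((ix j).1.2 - Complex.I * (ix j).1.1) with hd
  have heig : ∀ j, A.toEuclideanLin (b j) = d j • b j := fun j => by
    rw [hA2, map_smul, map_sub, map_smul, LinearMap.smul_apply, LinearMap.sub_apply,
      LinearMap.smul_apply, (hmem j).1, (hmem j).2, smul_smul, ← sub_smul, smul_smul]
  set U := (EuclideanSpace.basisFun (Fin n) ℂ).toBasis.toMatrix b with hU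
  have hUu : U ∈ Matrix.unitaryGroup (Fin n) ℂ :=
    OrthonormalBasis.toMatrix_orthonormalBasis_mem_unitary _ _
  refine ⟨U, hUu, d, ?_⟩
  have hAU : A * U = U * Matrix.diagonal d := by
    ext i j
    have := congrArg (fun v : EuclideanSpace ℂ (Fin n) => v i) (heig j)
    simp only [Matrix.toLpLin_apply, PiLp.smul_apply, smul_eq_mul, Matrix.mulVec,
      dotProduct] at this
    rw [Matrix.mul_diagonal, Matrix.mul_apply]
    simpa [hU, Module.Basis.toMatrix_apply, mul_comm] using this
  rw [← hAU, mul_assoc, Matrix.mem_unitaryGroup_iff.1 hUu, mul_one]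

theorem Matrix.roots_charpoly_unitary_conj_diagonal {n : ℕ} {U : Matrix (Fin n) (Fin n) ℂ}
    (hU : U ∈ Matrix.unitaryGroup (Fin n) ℂ) (d : Fin n → ℂ) :
    (U * Matrix.diagonal d * star U).charpoly.roots = Finset.univ.val.map d := by
  have h := Matrix.charpoly_units_conj (Unitary.toUnits ⟨U, hU⟩) (Matrix.diagonal d)
  have e : ((Unitary.toUnits ⟨U, hU⟩)⁻¹ : (Matrix (Fin n) (Fin n) ℂ)ˣ).val = star U := rfl
  rw [← Matrix.coe_units_inv, e] at h
  refine (congrArg Polynomial.roots h).trans ?_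
  rw [Matrix.charpoly_diagonal, show (∏ i, (Polynomial.X - Polynomial.C (d i))) =
    ((Finset.univ.val.map d).map fun a => Polynomial.X - Polynomial.C a).prod by
      rw [Multiset.map_map]; rfl, Polynomial.roots_multiset_prod_X_sub_C]

theorem Matrix.exp_unitary_conj_diagonal {n : ℕ} {U : Matrix (Fin n) (Fin n) ℂ}
    (hU : U ∈ Matrix.unitaryGroup (Fin n) ℂ) (d : Fin n → ℂ) :
    NormedSpace.exp (U * Matrix.diagonal d * star U) =
      U * Matrix.diagonal (fun j => Complex.exp (d j)) * star U := by
  have h := Matrix.exp_units_conj (Unitary.toUnits ⟨U, hU⟩) (Matrix.diagonal d)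
  have e : ((Unitary.toUnits ⟨U, hU⟩)⁻¹ : (Matrix (Fin n) (Fin n) ℂ)ˣ).val = star U := rfl
  rw [e, Matrix.exp_diagonal] at h
  refine h.trans ?_
  congr 3
  funext j
  rw [Pi.coe_exp, Complex.exp_eq_exp_ℂ]

/-- The entrywise inclusion is a continuous ring homomorphism, so it passes through the exponential
series. -/
theorem Matrix.exp_map_ofReal {n : ℕ} (L : Matrix (Fin n) (Fin n) ℝ) :
    (NormedSpace.exp L).map (algebraMap ℝ ℂ) = NormedSpace.exp (L.map (algebraMap ℝ ℂ)) := by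
  open scoped Matrix.Norms.Operator in
  exact NormedSpace.map_exp (algebraMap ℝ ℂ).mapMatrix
    (continuous_id.matrix_map Complex.continuous_ofReal) L

/-! ### Spectral coordinates and their Gaussian noise -/

section SpectralNoise

/-- The `j`-th coordinate of a real vector in the orthonormal basis given by the columns of `U`. -/
noncomputable def spectralCoord {n : ℕ} (U : Matrix (Fin n) (Fin n) ℂ) (j : Fin n) :
    EuclideanSpace ℝ (Fin n) →L[ℝ] ℂ :=
  ∑ i, (star (U i j)) • (Complex.ofRealCLM ∘L EuclideanSpace.proj i)

theorem spectralCoord_apply {n : ℕ} (U : Matrix (Fin n) (Fin n) ℂ) (j : Fin n)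
    (x : EuclideanSpace ℝ (Fin n)) :
    spectralCoord U j x = ∑ i, star (U i j) * (x i : ℂ) := by
  simp [spectralCoord]

theorem spectralCoord_eq_mulVec {n : ℕ} (U : Matrix (Fin n) (Fin n) ℂ)
    (x : EuclideanSpace ℝ (Fin n)) :
    (fun j => spectralCoord U j x) = Matrix.mulVec (star U) fun i => (x i : ℂ) := by
  funext j
  rw [spectralCoord_apply]
  rfl

theorem sum_mul_spectralCoord {n : ℕ} {U : Matrix (Fin n) (Fin n) ℂ}
    (hU : U ∈ Matrix.unitaryGroup (Fin n) ℂ) (x : EuclideanSpace ℝ (Fin n)) (i : Fin n) :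
    ∑ j, U i j * spectralCoord U j x = x i := by
  have h : Matrix.mulVec U (fun j => spectralCoord U j x) = fun i => (x i : ℂ) := by
    rw [spectralCoord_eq_mulVec, Matrix.mulVec_mulVec, Matrix.mem_unitaryGroup_iff.1 hU,
      Matrix.one_mulVec]
  exact congrFun h i

theorem sum_norm_sq_spectralCoord {n : ℕ} {U : Matrix (Fin n) (Fin n) ℂ}
    (hU : U ∈ Matrix.unitaryGroup (Fin n) ℂ) (x : EuclideanSpace ℝ (Fin n)) :
    ∑ j, ‖spectralCoord U j x‖ ^ 2 = ‖x‖ ^ 2 := by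
  have h : ∑ j, star (spectralCoord U j x) * spectralCoord U j x = ∑ i, (x i : ℂ) * x i := by
    have e : ∀ j, star (spectralCoord U j x) = ∑ i, (x i : ℂ) * U i j := fun j => by
      rw [spectralCoord_apply, star_sum]
      refine Finset.sum_congr rfl fun i _ => ?_
      rw [star_mul, star_star]
      simp
    simp_rw [e, Finset.sum_mul]
    rw [Finset.sum_comm]
    refine Finset.sum_congr rfl fun i _ => ?_
    simp_rw [mul_assoc]
    rw [← Finset.mul_sum, sum_mul_spectralCoord hU]
  rw [EuclideanSpace.norm_sq_eq, ← Complex.ofReal_inj]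
  push_cast
  refine (Finset.sum_congr rfl fun j _ => ?_).trans
    (h.trans (Finset.sum_congr rfl fun i _ => ?_))
  · exact (Complex.conj_mul' _).symm
  · rw [← Complex.ofReal_pow, Real.norm_eq_abs, sq_abs]
    push_cast
    ring

theorem sum_norm_sq_column {n : ℕ} {U : Matrix (Fin n) (Fin n) ℂ}
    (hU : U ∈ Matrix.unitaryGroup (Fin n) ℂ) (j : Fin n) : ∑ i, ‖star (U i j)‖ ^ 2 = 1 := by
  have h := congrFun (congrFun (Matrix.mem_unitaryGroup_iff'.1 hU) j) j
  rw [Matrix.mul_apply, Matrix.one_apply_eq] at h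
  rw [← Complex.ofReal_inj]
  push_cast
  refine (Finset.sum_congr rfl fun i _ => ?_).trans h
  rw [norm_star, ← Complex.conj_mul']
  rfl

/-- Stated for any real matrix diagonalized by `U`, because it serves both for `L`, to decouple the
equation, and for its exponential. -/
theorem spectralCoord_toEuclideanLin {n : ℕ} {U : Matrix (Fin n) (Fin n) ℂ}
    (hU : U ∈ Matrix.unitaryGroup (Fin n) ℂ) {A : Matrix (Fin n) (Fin n) ℝ} {d : Fin n → ℂ}
    (hA : A.map (algebraMap ℝ ℂ) = U * Matrix.diagonal d * star U)
    (x : EuclideanSpace ℝ (Fin n)) (j : Fin n) :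
    spectralCoord U j (A.toEuclideanLin x) = d j * spectralCoord U j x := by
  have h1 : (fun i => ((A.toEuclideanLin x) i : ℂ)) =
      Matrix.mulVec (A.map (algebraMap ℝ ℂ)) fun i => (x i : ℂ) := by
    funext i
    simp [Matrix.toLpLin_apply, Matrix.mulVec, dotProduct]
  have h2 := congrFun (spectralCoord_eq_mulVec U (A.toEuclideanLin x)) j
  rw [h1, hA, Matrix.mulVec_mulVec, mul_assoc, ← mul_assoc, Matrix.mem_unitaryGroup_iff'.1 hU,
    one_mul, ← Matrix.mulVec_mulVec, ← spectralCoord_eq_mulVec, Matrix.mulVec_diagonal] at h2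
  exact h2

theorem re_intervalIntegral {F : ℝ → ℂ} (hF : Continuous F) (a b : ℝ) :
    (∫ s in a..b, F s).re = ∫ s in a..b, (F s).re :=
  (Complex.reCLM.intervalIntegral_comp_comm (hF.intervalIntegrable a b)).symm

/-- Gives the real part of the noise the shape of `hasLaw_wienerIntegral` with `h s = Re (a
e^{(t-s)z})`; the factor `e^{(t-t)z} = 1` is left unsimplified to match `h t`. -/
theorem re_mul_integral_by_parts {b : ℝ → ℝ} (hb : Continuous b) (a z : ℂ) (t : ℝ) :
    (a * (b t + ∫ s in (0 : ℝ)..t, z * Complex.exp (((t : ℂ) - s) * z) * b s)).re =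
      (a * Complex.exp (((t : ℂ) - t) * z)).re * b t -
        ∫ s in (0 : ℝ)..t, -(a * (z * Complex.exp (((t : ℂ) - s) * z))).re * b s := by
  rw [mul_add, Complex.add_re, ← intervalIntegral.integral_const_mul,
    re_intervalIntegral (by fun_prop), sub_eq_add_neg, ← intervalIntegral.integral_neg]
  congr 1
  · simp
  · refine intervalIntegral.integral_congr fun s _ => ?_
    simp only [neg_mul, neg_neg]
    rw [← Complex.re_mul_ofReal]
    congr 1
    ring

variable {Ω : Type*} {n : ℕ}

/-- The random part `∑ᵢ aᵢ ∫₀ᵗ e^{(t-s)z} dWⁱ_s` of a complex Ornstein–Uhlenbeck process, written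
through integration by parts. -/
noncomputable def complexNoise (W : ℝ≥0 → Ω → EuclideanSpace ℝ (Fin n)) (a : Fin n → ℂ) (z : ℂ) (t : ℝ≥0)
    (ω : Ω) : ℂ :=
  ∑ i, a i * (W t ω i +
    ∫ s in (0 : ℝ)..t, z * Complex.exp (((t : ℂ) - s) * z) * W s.toNNReal ω i)

theorem complexNoise_const_mul (W : ℝ≥0 → Ω → EuclideanSpace ℝ (Fin n)) (b : ℂ) (a : Fin n → ℂ)
    (z : ℂ) (t : ℝ≥0) (ω : Ω) :
    complexNoise W (fun i => b * a i) z t ω = b * complexNoise W a z t ω := by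
  rw [complexNoise, complexNoise, Finset.mul_sum]
  simp_rw [mul_assoc]

variable [MeasurableSpace Ω] {P : Measure Ω} [IsProbabilityMeasure P]

theorem hasLaw_re_complexNoise {W : ℝ≥0 → Ω → EuclideanSpace ℝ (Fin n)}
    (hW : IsStandardWiener W P) (a : Fin n → ℂ) (z : ℂ) (t : ℝ≥0) :
    HasLaw (fun ω => (complexNoise W a z t ω).re) (gaussianReal 0
      (∑ i, ∫ s in (0 : ℝ)..t, (a i * Complex.exp (((t : ℂ) - s) * z)).re ^ 2).toNNReal) P := by
  have hder : ∀ i (s : ℝ), HasDerivAt (fun s : ℝ => (a i * Complex.exp (((t : ℂ) - s) * z)).re)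
      (-(a i * (z * Complex.exp (((t : ℂ) - s) * z))).re) s := fun i s => by
    have h0 : HasDerivAt (fun s : ℝ => (s : ℂ)) 1 s := Complex.ofRealCLM.hasDerivAt
    have h1 := (((h0.const_sub (t : ℂ)).mul_const z).cexp).const_mul (a i)
    refine (Complex.reCLM.hasFDerivAt.comp_hasDerivAt s h1).congr_deriv ?_
    rw [Complex.reCLM_apply, ← Complex.neg_re]
    congr 1
    ring
  refine (hasLaw_wienerIntegral hW hder (fun i => by fun_prop) t).congr ?_
  have hc : ∀ᵐ ω ∂P, ∀ i, Continuous (fun s => W s ω i) :=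
    ae_all_iff.2 fun i => (hW.isBrownian i).cont
  filter_upwards [hc] with ω hω
  rw [complexNoise, Complex.re_sum]
  refine Finset.sum_congr rfl fun i _ => ?_
  have h := re_mul_integral_by_parts (b := fun s : ℝ => W s.toNNReal ω i)
    ((hω i).comp continuous_real_toNNReal) (a i) z t
  rw [Real.toNNReal_coe] at h
  exact h

theorem hasLaw_im_complexNoise {W : ℝ≥0 → Ω → EuclideanSpace ℝ (Fin n)}
    (hW : IsStandardWiener W P) (a : Fin n → ℂ) (z : ℂ) (t : ℝ≥0) :
    HasLaw (fun ω => (complexNoise W a z t ω).im) (gaussianReal 0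
      (∑ i, ∫ s in (0 : ℝ)..t, (a i * Complex.exp (((t : ℂ) - s) * z)).im ^ 2).toNNReal) P := by
  -- `Im w = Re (-i w)`, and the factor `-i` is absorbed into the coefficients.
  have h := hasLaw_re_complexNoise hW (fun i => -Complex.I * a i) z t
  simp_rw [complexNoise_const_mul, mul_assoc] at h
  simpa using h

theorem memLp_add_mul_complexNoise {W : ℝ≥0 → Ω → EuclideanSpace ℝ (Fin n)}
    (hW : IsStandardWiener W P) (e : ℂ) (c : ℝ) (a : Fin n → ℂ) (z : ℂ) (t : ℝ≥0) :
    MemLp (fun ω => e + c * complexNoise W a z t ω) 2 P := by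
  have hre : MemLp (fun ω => ((complexNoise W a z t ω).re : ℂ)) 2 P :=
    (memLp_of_hasLaw_gaussianReal (hasLaw_re_complexNoise hW a z t)).ofReal (K := ℂ)
  have him : MemLp (fun ω => ((complexNoise W a z t ω).im : ℂ)) 2 P :=
    (memLp_of_hasLaw_gaussianReal (hasLaw_im_complexNoise hW a z t)).ofReal (K := ℂ)
  have h := (memLp_const e).add ((hre.add (him.const_mul Complex.I)).const_mul (c : ℂ))
  convert! h using 1
  funext ω
  simp only [Pi.add_apply]
  rw [mul_comm Complex.I, Complex.re_add_im]

/-- The real and imaginary parts may be correlated, but the squared modulus involves only their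
separate second moments. The two variances add up through `(Re w)² + (Im w)² = |w|²`. -/
theorem integral_norm_sq_add_mul_complexNoise {W : ℝ≥0 → Ω → EuclideanSpace ℝ (Fin n)}
    (hW : IsStandardWiener W P) (e : ℂ) (c : ℝ) (a : Fin n → ℂ) (z : ℂ) (t : ℝ≥0) :
    ∫ ω, ‖e + c * complexNoise W a z t ω‖ ^ 2 ∂P = ‖e‖ ^ 2 +
      c ^ 2 * ((∑ i, ‖a i‖ ^ 2) * ∫ s in (0 : ℝ)..t, ‖Complex.exp (((t : ℂ) - s) * z)‖ ^ 2) := by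
  have hre := hasLaw_re_complexNoise hW a z t
  have him := hasLaw_im_complexNoise hW a z t
  have hsq : ∀ w : ℂ, ‖w‖ ^ 2 = w.re ^ 2 + w.im ^ 2 := fun w => by
    rw [Complex.sq_norm, Complex.normSq_apply, sq, sq]
  have hi : ∀ {R : Ω → ℝ} {v : ℝ≥0} (e : ℝ), HasLaw R (gaussianReal 0 v) P →
      Integrable (fun ω => (e + c * R ω) ^ 2) P := fun e h =>
    ((memLp_const e).add ((memLp_of_hasLaw_gaussianReal h).const_mul c)).integrable_sq
  have hnn : ∀ g : Fin n → ℝ → ℝ, ((∑ i, ∫ s in (0 : ℝ)..t, g i s ^ 2).toNNReal : ℝ) =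
      ∑ i, ∫ s in (0 : ℝ)..t, g i s ^ 2 := fun g =>
    Real.coe_toNNReal _ (Finset.sum_nonneg fun i _ =>
      intervalIntegral.integral_nonneg t.2 fun s _ => sq_nonneg _)
  simp_rw [hsq (e + _)]
  simp only [Complex.add_re, Complex.add_im, Complex.re_ofReal_mul, Complex.im_ofReal_mul]
  rw [integral_add (hi _ hre) (hi _ him), integral_add_mul_sq_of_hasLaw_gaussianReal hre,
    integral_add_mul_sq_of_hasLaw_gaussianReal him, hnn fun i s => (a i * _).re,
    hnn fun i s => (a i * _).im, hsq e]
  have hsum : (∑ i, ∫ s in (0 : ℝ)..t, (a i * Complex.exp (((t : ℂ) - s) * z)).re ^ 2) +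
      ∑ i, ∫ s in (0 : ℝ)..t, (a i * Complex.exp (((t : ℂ) - s) * z)).im ^ 2 =
      (∑ i, ‖a i‖ ^ 2) * ∫ s in (0 : ℝ)..t, ‖Complex.exp (((t : ℂ) - s) * z)‖ ^ 2 := by
    rw [← Finset.sum_add_distrib, Finset.sum_mul]
    refine Finset.sum_congr rfl fun i _ => ?_
    rw [← intervalIntegral.integral_add (Continuous.intervalIntegrable (by fun_prop) _ _)
      (Continuous.intervalIntegrable (by fun_prop) _ _), ← intervalIntegral.integral_const_mul]
    refine intervalIntegral.integral_congr fun s _ => ?_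
    simp only [← hsq, norm_mul, mul_pow]
  rw [← hsum]
  ring

end SpectralNoise

/-! ### Solution of the equation and its second moment -/

section Solution

variable {Ω : Type*} {n : ℕ} [MeasurableSpace Ω] {P : Measure Ω}

/-- The spectral coordinates of the solution of the linear SDE are complex Ornstein–Uhlenbeck
processes. -/
theorem spectralCoord_solution {U : Matrix (Fin n) (Fin n) ℂ}
    (hU : U ∈ Matrix.unitaryGroup (Fin n) ℂ) {L : Matrix (Fin n) (Fin n) ℝ} {d : Fin n → ℂ}
    (hL : L.map (algebraMap ℝ ℂ) = U * Matrix.diagonal d * star U) {c : ℝ}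
    {W : ℝ≥0 → Ω → EuclideanSpace ℝ (Fin n)} (hW : IsStandardWiener W P)
    {x₀ : EuclideanSpace ℝ (Fin n)} {X : ℝ≥0 → Ω → EuclideanSpace ℝ (Fin n)}
    (hX : IsLinearSDESolution L (c • (1 : Matrix (Fin n) (Fin n) ℝ)) W x₀ X P) (t : ℝ≥0) :
    ∀ᵐ ω ∂P, ∀ j, spectralCoord U j (X t ω) = Complex.exp (t * d j) * spectralCoord U j x₀ +
      c * complexNoise W (fun i => star (U i j)) (d j) t ω := by
  have hc : ∀ᵐ ω ∂P, ∀ i, Continuous (fun s => W s ω i) :=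
    ae_all_iff.2 fun i => (hW.isBrownian i).cont
  have h0 : ∀ᵐ ω ∂P, ∀ i, W 0 ω i = 0 :=
    ae_all_iff.2 fun i => (hW.isBrownian i).eval_zero_ae_eq_zero
  filter_upwards [hc, h0, hX.continuous_paths, hX.integral_eq] with ω hWc hW0 hXc hXi j
  have hWc' : ∀ i, Continuous fun s : ℝ => W s.toNNReal ω i := fun i =>
    (hWc i).comp continuous_real_toNNReal
  have hXc' : Continuous fun s : ℝ => X s.toNNReal ω := hXc.comp continuous_real_toNNReal
  have hM : Continuous fun s : ℝ => spectralCoord U j (W s.toNNReal ω) := by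
    simp_rw [spectralCoord_apply]
    exact continuous_finsetSum _ fun i _ =>
      continuous_const.mul (Complex.continuous_ofReal.comp (hWc' i))
  have hLc : Continuous fun s : ℝ => L.toEuclideanLin (X s.toNNReal ω) :=
    (LinearMap.continuous_of_finiteDimensional _).comp hXc'
  have hW00 : W 0 ω = 0 := by
    ext i
    simpa using hW0 i
  have key := variation_of_constants (Y := fun s : ℝ => spectralCoord U j (X s.toNNReal ω))
    (M := fun s : ℝ => spectralCoord U j (W s.toNNReal ω)) (y := spectralCoord U j x₀) (z := d j)
    -- The spectral coordinate is continuous and linear, so it goes under the integral, where `L`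
    -- becomes multiplication by `d j`; the scalar matrix acts on `W` as `c`.
    (c := c) ((spectralCoord U j).continuous.comp hXc') hM (t := t) t.2 (fun s hs => by
      have h := hXi s.toNNReal
      rw [Real.coe_toNNReal s hs.1, hW00, sub_zero] at h
      have hB : (c • (1 : Matrix (Fin n) (Fin n) ℝ)).toEuclideanLin (W s.toNNReal ω) =
          c • W s.toNNReal ω := by
        rw [map_smul, LinearMap.smul_apply]
        simp
      rw [h, hB, map_add, map_add, map_smul, Complex.real_smul,
        ← ContinuousLinearMap.intervalIntegral_comp_comm _ (hLc.intervalIntegrable _ _)]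
      simp_rw [spectralCoord_toEuclideanLin hU hL])
  simp only [Real.toNNReal_coe] at key
  rw [key, complexNoise]
  congr 2
  simp_rw [spectralCoord_apply, mul_add, Finset.sum_add_distrib, Finset.mul_sum]
  congr 1
  have hcont : ∀ i, Continuous fun s : ℝ =>
      d j * Complex.exp (((t : ℂ) - s) * d j) * (star (U i j) * (W s.toNNReal ω i : ℂ)) := fun i =>
    (by fun_prop : Continuous fun s : ℝ => d j * Complex.exp (((t : ℂ) - s) * d j)).mul
      (continuous_const.mul (Complex.continuous_ofReal.comp (hWc' i)))
  refine (intervalIntegral.integral_finsetSum fun i _ =>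
    (hcont i).intervalIntegrable _ _).trans ?_
  refine Finset.sum_congr rfl fun i _ => ?_
  rw [← intervalIntegral.integral_const_mul]
  congr 1
  funext s
  ring

theorem norm_sq_exp_smul_toEuclideanLin {U : Matrix (Fin n) (Fin n) ℂ}
    (hU : U ∈ Matrix.unitaryGroup (Fin n) ℂ) {L : Matrix (Fin n) (Fin n) ℝ} {d : Fin n → ℂ}
    (hL : L.map (algebraMap ℝ ℂ) = U * Matrix.diagonal d * star U) (t : ℝ)
    (x : EuclideanSpace ℝ (Fin n)) :
    ‖(NormedSpace.exp (t • L)).toEuclideanLin x‖ ^ 2 =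
      ∑ j, ‖Complex.exp (t * d j) * spectralCoord U j x‖ ^ 2 := by
  have h : (t • L).map (algebraMap ℝ ℂ) =
      U * Matrix.diagonal (fun j => t * d j) * star U := by
    have e1 : (t • L).map (algebraMap ℝ ℂ) = (t : ℂ) • L.map (algebraMap ℝ ℂ) := by
      ext i j
      simp
    have e2 : Matrix.diagonal (fun j => t * d j) = (t : ℂ) • Matrix.diagonal d := by
      rw [← Matrix.diagonal_smul]
      rfl
    rw [e1, e2, hL, mul_smul_comm, smul_mul_assoc]
  have hexp : (NormedSpace.exp (t • L)).map (algebraMap ℝ ℂ) =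
      U * Matrix.diagonal (fun j => Complex.exp (t * d j)) * star U := by
    rw [Matrix.exp_map_ofReal, h, Matrix.exp_unitary_conj_diagonal hU]
  rw [← sum_norm_sq_spectralCoord hU]
  simp_rw [spectralCoord_toEuclideanLin hU hexp]

end Solution

theorem corollary5 {Ω : Type*} [MeasurableSpace Ω] (P : Measure Ω) [IsProbabilityMeasure P]
    {n : ℕ} (L B : Matrix (Fin n) (Fin n) ℝ) (c : ℝ)
    (hB : B = c • (1 : Matrix (Fin n) (Fin n) ℝ)) (hL : IsStarNormal L)
    (W : ℝ≥0 → Ω → EuclideanSpace ℝ (Fin n)) (hW : IsStandardWiener W P)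
    (x₀ : EuclideanSpace ℝ (Fin n))
    (X : ℝ≥0 → Ω → EuclideanSpace ℝ (Fin n)) (hX : IsLinearSDESolution L B W x₀ X P)
    (t : ℝ≥0) (ht : t ≤ 1) :
    MemLp (X t) 2 P ∧
    Summable (fun k : ℕ =>
      ((complexEigenvalues L).map fun z => ‖phiCos klFreq (k + 1) t z‖ ^ 2).sum) ∧
    ∫ ω, ‖X t ω‖ ^ 2 ∂P =
      ‖(NormedSpace.exp ((t : ℝ) • L)).toEuclideanLin x₀‖ ^ 2
        + 2 * c ^ 2 * ∑' k : ℕ,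
          ((complexEigenvalues L).map fun z => ‖phiCos klFreq (k + 1) t z‖ ^ 2).sum := by
  subst hB
  have hLn : IsStarNormal (L.map (algebraMap ℝ ℂ)) := by
    refine ⟨?_⟩
    have h := congrArg (algebraMap ℝ ℂ).mapMatrix hL.star_comm_self.eq
    have e : star (L.map (algebraMap ℝ ℂ)) = (star L).map (algebraMap ℝ ℂ) := by
      ext i j
      simp [Matrix.star_apply]
    rw [Commute, SemiconjBy, e]
    simpa only [map_mul, RingHom.mapMatrix_apply] using h
  obtain ⟨U, hU, d, hd⟩ := Matrix.exists_unitary_diagonalization _ hLn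
  have hroots : complexEigenvalues L = Finset.univ.val.map d := by
    rw [complexEigenvalues, hd, Matrix.roots_charpoly_unitary_conj_diagonal hU]
  have hphi : ∀ k : ℕ, ((complexEigenvalues L).map fun z => ‖phiCos klFreq (k + 1) t z‖ ^ 2).sum =
      ∑ j, ‖phiCos klFreq (k + 1) t (d j)‖ ^ 2 := fun k => by
    rw [hroots, Multiset.map_map]
    rfl
  have hsum : HasSum (fun k : ℕ =>
      ((complexEigenvalues L).map fun z => ‖phiCos klFreq (k + 1) t z‖ ^ 2).sum)
      -- The `2⁻¹` undoes the factor `2` of Parseval's identity.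
      (2⁻¹ * ∑ j, ∫ s in (0 : ℝ)..t, ‖Complex.exp (((t : ℂ) - s) * d j)‖ ^ 2) := by
    have h := (hasSum_sum (s := Finset.univ) fun j _ =>
      hasSum_sq_norm_phiCos t.2 (NNReal.coe_le_one.2 ht) (d j)).mul_left (2⁻¹ : ℝ)
    refine h.congr_fun fun k => ?_
    rw [hphi, ← Finset.mul_sum]
    simp
  have hsol := spectralCoord_solution hU hd hW hX t
  have hsolj : ∀ j, (fun ω => Complex.exp (t * d j) * spectralCoord U j x₀ +
      c * complexNoise W (fun i => star (U i j)) (d j) t ω) =ᵐ[P]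
      fun ω => spectralCoord U j (X t ω) := fun j => by
    filter_upwards [hsol] with ω hω using (hω j).symm
  have hmem : ∀ j, MemLp (fun ω => spectralCoord U j (X t ω)) 2 P := fun j =>
    (memLp_add_mul_complexNoise hW _ c _ _ t).ae_eq (hsolj j)
  refine ⟨MemLp.of_eval_piLp fun i => ?_, hsum.summable, ?_⟩
  -- Square-integrability returns to the real coordinates of `X t` by inverting `U`.
  · have h : MemLp (fun ω => ∑ j, U i j * spectralCoord U j (X t ω)) 2 P :=
      memLp_finsetSum _ fun j _ => (hmem j).const_mul (U i j)
    simp_rw [sum_mul_spectralCoord hU] at h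
    simpa using h.re
  · have hint : ∀ j, ∫ ω, ‖spectralCoord U j (X t ω)‖ ^ 2 ∂P =
        ‖Complex.exp (t * d j) * spectralCoord U j x₀‖ ^ 2 +
          c ^ 2 * ∫ s in (0 : ℝ)..t, ‖Complex.exp (((t : ℂ) - s) * d j)‖ ^ 2 := fun j => by
      have h := integral_norm_sq_add_mul_complexNoise hW
        (Complex.exp (t * d j) * spectralCoord U j x₀) c (fun i => star (U i j)) (d j) t
      rw [sum_norm_sq_column hU, one_mul] at h
      rw [← h]
      refine integral_congr_ae ?_
      filter_upwards [hsolj j] with ω hω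
      rw [hω]
    -- The squared norm is a sum over spectral coordinates, so correlations between different `j`
    -- play no role.
    simp_rw [← sum_norm_sq_spectralCoord hU (X t _)]
    rw [integral_finsetSum _ fun j _ => (hmem j).integrable_norm_pow two_ne_zero, hsum.tsum_eq,
      norm_sq_exp_smul_toEuclideanLin hU hd]
    simp_rw [hint]
    rw [Finset.sum_add_distrib, ← Finset.mul_sum]
    ring
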